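/- For a unit vector $q\in\mathbb{R}^n$ let $P_q$ denote the orthogonal projection of $\mathbb{R}^n$ onto the hyperplane $\{z\in\mathbb{R}^n : \langle q,z\rangle=0\}$. A convex compact set $A\subset\mathbb{R}^n$ is called a $P$-set if, for every unit vector $q\in\mathbb{R}^n$, the function $$f_{A,q}\colon P_qA\to\mathbb{R},\qquad f_{A,q}(x)=\min\{\mu\in\mathbb{R} : x+\mu q\in A\},$$ is continuous on $P_qA$. Theorem. A convex compact set $A\subset\mathbb{R}^n$ is a $P$-set if and only if, for every natural number $m$ and every linear map $L\colon\mathbb{R}^n\to\mathbb{R}^m$, the map $L\colon A\to LA$ is open, where $A$ and $LA$ carry the topologies induced from $\mathbb{R}^n$ and $\mathbb{R}^m$. -/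

import Mathlib

/-- The hyperplane `{z | ⟨q, z⟩ = 0}` of `ℝⁿ`, as a linear subspace. -/
noncomputable def orthHyperplane {n : ℕ} (q : EuclideanSpace ℝ (Fin n)) :
    Submodule ℝ (EuclideanSpace ℝ (Fin n)) :=
  (Submodule.span ℝ {q})ᗮ

/-- The orthogonal projection of `ℝⁿ` onto the hyperplane `{z | ⟨q, z⟩ = 0}`. -/
noncomputable def projHyperplane {n : ℕ} (q : EuclideanSpace ℝ (Fin n)) :
    EuclideanSpace ℝ (Fin n) →L[ℝ] orthHyperplane q :=
  (Submodule.span ℝ {q})ᗮ.orthogonalProjectionOnto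

/-- The function `x ↦ min {μ | x + μ q ∈ A}`, which is used for `x` in the projection of `A`
onto the hyperplane orthogonal to `q`. The infimum is a minimum there for compact `A` and
unit vectors `q`, see `isLeast_lowerFunction`. -/
noncomputable def lowerFunction {n : ℕ} (A : Set (EuclideanSpace ℝ (Fin n)))
    (q : EuclideanSpace ℝ (Fin n)) (x : orthHyperplane q) : ℝ :=
  sInf {μ : ℝ | (x : EuclideanSpace ℝ (Fin n)) + μ • q ∈ A}

/-- The infimum in `lowerFunction` is attained. -/
theorem isLeast_lowerFunction {n : ℕ} {A : Set (EuclideanSpace ℝ (Fin n))} (hA : IsCompact A)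
    {q : EuclideanSpace ℝ (Fin n)} (hq : ‖q‖ = 1) {x : orthHyperplane q}
    (hx : x ∈ projHyperplane q '' A) :
    IsLeast {μ : ℝ | (x : EuclideanSpace ℝ (Fin n)) + μ • q ∈ A} (lowerFunction A q x) := by
  have hcont : Continuous fun μ : ℝ => (x : EuclideanSpace ℝ (Fin n)) + μ • q := by fun_prop
  have hclosed : IsClosed {μ : ℝ | (x : EuclideanSpace ℝ (Fin n)) + μ • q ∈ A} :=
    hA.isClosed.preimage hcont
  have hne : {μ : ℝ | (x : EuclideanSpace ℝ (Fin n)) + μ • q ∈ A}.Nonempty := by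
    obtain ⟨z, hz, rfl⟩ := hx
    refine ⟨inner ℝ q z, ?_⟩
    have h1 := Submodule.starProjection_add_starProjection_orthogonal (K := Submodule.span ℝ {q}) z
    rw [Submodule.starProjection_unit_singleton ℝ hq] at h1
    have h2 : ((projHyperplane q z : orthHyperplane q) : EuclideanSpace ℝ (Fin n))
        = (Submodule.span ℝ {q})ᗮ.starProjection z := rfl
    rw [Set.mem_ofPred_eq, h2, add_comm, h1]
    exact hz
  have hbdd : BddBelow {μ : ℝ | (x : EuclideanSpace ℝ (Fin n)) + μ • q ∈ A} := by
    obtain ⟨C, hC⟩ := hA.isBounded.exists_norm_le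
    refine ⟨-(C + ‖(x : EuclideanSpace ℝ (Fin n))‖), fun μ hμ => ?_⟩
    have h3 : ‖μ • q‖ ≤ C + ‖(x : EuclideanSpace ℝ (Fin n))‖ := by
      have h4 := norm_sub_le ((x : EuclideanSpace ℝ (Fin n)) + μ • q) x
      rw [add_sub_cancel_left] at h4
      linarith [hC _ hμ]
    rw [norm_smul, hq, mul_one, Real.norm_eq_abs] at h3
    linarith [neg_abs_le μ]
  exact ⟨hclosed.csInf_mem hne hbdd, fun μ hμ => csInf_le hbdd hμ⟩

/-- `P`-sets: convex compact sets `A` in `ℝⁿ` such that, for every unit vector `q`, the function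
`x ↦ min {μ | x + μ q ∈ A}` is continuous on the projection of `A` onto the hyperplane
orthogonal to `q`. -/
def IsPSet {n : ℕ} (A : Set (EuclideanSpace ℝ (Fin n))) : Prop :=
  Convex ℝ A ∧ IsCompact A ∧
    ∀ q : EuclideanSpace ℝ (Fin n), ‖q‖ = 1 →
      ContinuousOn (lowerFunction A q) (projHyperplane q '' A)

/-!
Orthogonal projections along lines are the universal test maps for openness on a compact convex set
`A`. If `f_{A,q}` and `f_{A,-q}` are continuous, the convex set `A` is the region between two
continuous graphs over `P_q A`, and clamping the height `⟨q, z⟩` between them gives a local section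
of `P_q` through `z`; so `P_q` is open on `A`. Openness of a general `L` at `z` is, by compactness
of `A`, a condition near each point `w` of the fibre of `L` through `z`. For `w ≠ z` the line
through `z` and `w` lies in that fibre, so `L` factors through the projection `P_q` along it, and
openness of `P_q` carries small neighbourhoods of `z` to points near `w`. Conversely, `f_{A,q}` is
the minimum of the continuous function `⟨q, ·⟩` over the fibres of `P_q` on `A`: it is always lower
semicontinuous, and it is upper semicontinuous once `P_q` is open on `A`.
-/

open Topology Filter Set

section Topology

variable {X Y Z : Type*} [TopologicalSpace X] [TopologicalSpace Y] [TopologicalSpace Z]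
  {f : X → Y} {A : Set X} {z : X}

/-- Openness at a point `z` of the map that `f` induces from `A` onto `f '' A`, stated with
neighbourhood filters of the ambient spaces so that no subtypes occur. -/
def OpenWithinAt (f : X → Y) (A : Set X) (z : X) : Prop :=
  𝓝[f '' A] (f z) ≤ map f (𝓝[A] z)

theorem isOpenMap_imageFactorization_iff :
    IsOpenMap (imageFactorization f A) ↔ ∀ z ∈ A, OpenWithinAt f A z := by
  rw [isOpenMap_iff_nhds_le, Subtype.forall]
  refine forall₂_congr fun z hz => ?_
  have hval : map (↑) (map (imageFactorization f A) (𝓝 ⟨z, hz⟩)) = map f (𝓝[A] z) := by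
    rw [← map_nhds_subtype_val ⟨z, hz⟩, map_map, map_map]
    rfl
  rw [← map_le_map_iff Subtype.val_injective, map_nhds_subtype_val, hval]
  rfl

namespace OpenWithinAt

theorem of_comp {g : Y → Z} (hg : Continuous g) (hinj : g.Injective)
    (h : OpenWithinAt (g ∘ f) A z) : OpenWithinAt f A z := by
  refine (map_le_map_iff hinj).1 ?_
  calc map g (𝓝[f '' A] (f z))
      ≤ 𝓝[g '' (f '' A)] (g (f z)) :=
        hg.continuousWithinAt.tendsto_nhdsWithin (mapsTo_image g _)
    _ ≤ map g (map f (𝓝[A] z)) := by rwa [← image_comp, map_map]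

theorem of_rightInvOn {s : Y → X} (hs : ContinuousWithinAt s (f '' A) (f z)) (hsz : s (f z) = z)
    (hsA : MapsTo s (f '' A) A) (hfs : RightInvOn s f (f '' A)) : OpenWithinAt f A z := by
  have hlim : Tendsto s (𝓝[f '' A] (f z)) (𝓝[A] z) := by
    simpa only [hsz] using hs.tendsto_nhdsWithin hsA
  exact le_map_of_right_inverse (eventually_mem_nhdsWithin.mono hfs) hlim

theorem eventually_exists_mem_eq {w : X} {U : Set X} (h : OpenWithinAt f A z)
    (hf : ContinuousWithinAt f A w) (hwz : f w = f z) (hU : U ∈ 𝓝[A] z) :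
    ∀ᶠ b in 𝓝[A] w, ∃ u ∈ U, f u = f b := by
  have hlim := hf.tendsto_nhdsWithin (mapsTo_image f A)
  rw [hwz] at hlim
  exact hlim (h (image_mem_map hU))

end OpenWithinAt

theorem eventually_forall_fiber_of_isCompact [T2Space Y] (hA : IsCompact A)
    (hf : ContinuousOn f A) {p : X → Prop} {y : Y}
    (hp : ∀ w ∈ A, f w = y → ∀ᶠ b in 𝓝[A] w, p b) :
    ∀ᶠ y' in 𝓝 y, ∀ b ∈ A, f b = y' → p b := by
  have := isCompact_iff_compactSpace.1 hA
  have hclosed : IsClosedMap (A.domRestrict f) := hf.domRestrict.isClosedMap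
  have hfiber : ∀ w ∈ A.domRestrict f ⁻¹' {y}, ∀ᶠ b : A in 𝓝 w, p b := fun w hw => by
    have := hp w w.2 hw
    rwa [← map_nhds_subtype_val, eventually_map] at this
  filter_upwards [hclosed.eventually_nhds_fiber y hfiber] with y' hy' b hb hby
  exact hy' ⟨b, hb⟩ hby

theorem openWithinAt_of_isCompact [T2Space Y] (hA : IsCompact A) (hf : ContinuousOn f A)
    (h : ∀ U ∈ 𝓝[A] z, ∀ w ∈ A, f w = f z → ∀ᶠ b in 𝓝[A] w, ∃ u ∈ U, f u = f b) :
    OpenWithinAt f A z := by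
  intro V hV
  have hnear := eventually_forall_fiber_of_isCompact hA hf (h _ hV)
  filter_upwards [nhdsWithin_le_nhds hnear, self_mem_nhdsWithin]
  rintro _ hy ⟨b, hb, rfl⟩
  obtain ⟨u, hu, hub⟩ := hy b hb rfl
  exact hub ▸ hu

section Marginal

variable {α : Type*} [Preorder α] {h : X → α} {m : Y → α}

theorem lowerSemicontinuousOn_of_isLeast_fiber [T2Space Y] (hA : IsCompact A)
    (hf : ContinuousOn f A) (hh : LowerSemicontinuousOn h A)
    (hm : ∀ y ∈ f '' A, IsLeast (h '' (A ∩ f ⁻¹' {y})) (m y)) :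
    LowerSemicontinuousOn m (f '' A) := by
  intro y hy a ha
  have hnear := eventually_forall_fiber_of_isCompact hA hf fun w hw hwy =>
    hh w hw a (ha.trans_le ((hm y hy).2 ⟨w, ⟨hw, hwy⟩, rfl⟩))
  filter_upwards [nhdsWithin_le_nhds hnear, self_mem_nhdsWithin] with y' hy' hy'A
  obtain ⟨b, ⟨hb, hby⟩, hbm⟩ := (hm y' hy'A).1
  exact hbm ▸ hy' b hb hby

theorem upperSemicontinuousOn_of_isLeast_fiber (hf : ∀ z ∈ A, OpenWithinAt f A z)
    (hh : UpperSemicontinuousOn h A)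
    (hm : ∀ y ∈ f '' A, IsLeast (h '' (A ∩ f ⁻¹' {y})) (m y)) :
    UpperSemicontinuousOn m (f '' A) := by
  intro y hy a ha
  obtain ⟨z, ⟨hz, rfl⟩, hzm⟩ := (hm y hy).1
  refine hf z hz (mem_map.2 ?_)
  filter_upwards [hh z hz a (hzm.trans_lt ha), self_mem_nhdsWithin] with b hba hb
  exact ((hm _ (mem_image_of_mem f hb)).2 ⟨b, ⟨hb, rfl⟩, rfl⟩).trans_lt hba

end Marginal

end Topology

theorem ordConnected_setOf_add_smul_mem {𝕜 E : Type*} [Field 𝕜] [LinearOrder 𝕜]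
    [IsStrictOrderedRing 𝕜] [AddCommGroup E] [Module 𝕜 E] {A : Set E} (hA : Convex 𝕜 A)
    (x q : E) : OrdConnected {μ : 𝕜 | x + μ • q ∈ A} :=
  ((hA.translate_preimage_right x).linear_preimage (LinearMap.toSpanSingleton 𝕜 E q)).ordConnected

section Projection

variable {n : ℕ} {A : Set (EuclideanSpace ℝ (Fin n))} {q : EuclideanSpace ℝ (Fin n)}

theorem projHyperplane_eq_iff {u v : EuclideanSpace ℝ (Fin n)} :
    projHyperplane q u = projHyperplane q v ↔ u - v ∈ Submodule.span ℝ {q} := by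
  rw [← sub_eq_zero, ← map_sub, ← (Submodule.span ℝ {q}).orthogonal_orthogonal]
  exact Submodule.orthogonalProjectionOnto_eq_zero_iff

theorem projHyperplane_coe (x : orthHyperplane q) :
    projHyperplane q (x : EuclideanSpace ℝ (Fin n)) = x :=
  Submodule.orthogonalProjectionOnto_mem_subspace_eq_self x

theorem projHyperplane_coe_add_smul (x : orthHyperplane q) (μ : ℝ) :
    projHyperplane q ((x : EuclideanSpace ℝ (Fin n)) + μ • q) = x := by
  rw [← projHyperplane_coe x, projHyperplane_eq_iff, projHyperplane_coe, add_sub_cancel_left]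
  exact Submodule.smul_mem _ μ (Submodule.mem_span_singleton_self q)

theorem inner_coe_add_smul (hq : ‖q‖ = 1) (x : orthHyperplane q) (μ : ℝ) :
    inner ℝ q ((x : EuclideanSpace ℝ (Fin n)) + μ • q) = μ := by
  rw [inner_add_right, Submodule.mem_orthogonal_singleton_iff_inner_right.1 x.2,
    inner_smul_right, real_inner_self_eq_norm_sq, hq, one_pow, mul_one, zero_add]

theorem coe_projHyperplane_add_inner_smul (hq : ‖q‖ = 1) (z : EuclideanSpace ℝ (Fin n)) :
    (projHyperplane q z : EuclideanSpace ℝ (Fin n)) + inner ℝ q z • q = z := by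
  rw [← Submodule.starProjection_unit_singleton ℝ hq, add_comm]
  exact Submodule.starProjection_add_starProjection_orthogonal z

theorem setOf_coe_add_smul_mem_eq_image_inner (hq : ‖q‖ = 1) (x : orthHyperplane q) :
    {μ : ℝ | (x : EuclideanSpace ℝ (Fin n)) + μ • q ∈ A} =
      inner ℝ q '' (A ∩ projHyperplane q ⁻¹' {x}) := by
  ext μ
  constructor
  · exact fun hμ => ⟨_, ⟨hμ, projHyperplane_coe_add_smul x μ⟩, inner_coe_add_smul hq x μ⟩
  · rintro ⟨z, ⟨hz, rfl⟩, rfl⟩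
    rwa [mem_ofPred_eq, coe_projHyperplane_add_inner_smul hq]

theorem continuousOn_lowerFunction (hA : IsCompact A) (hq : ‖q‖ = 1)
    (hopen : ∀ z ∈ A, OpenWithinAt (projHyperplane q) A z) :
    ContinuousOn (lowerFunction A q) (projHyperplane q '' A) := by
  have hinner : ContinuousOn (fun z => inner ℝ q z) A := by fun_prop
  have hleast : ∀ x ∈ projHyperplane q '' A,
      IsLeast (inner ℝ q '' (A ∩ projHyperplane q ⁻¹' {x})) (lowerFunction A q x) :=
    fun x hx => setOf_coe_add_smul_mem_eq_image_inner hq x ▸ isLeast_lowerFunction hA hq hx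
  exact continuousOn_iff_lower_upperSemicontinuousOn.2
    ⟨lowerSemicontinuousOn_of_isLeast_fiber hA (projHyperplane q).continuous.continuousOn
      hinner.lowerSemicontinuousOn hleast,
    upperSemicontinuousOn_of_isLeast_fiber hopen hinner.upperSemicontinuousOn hleast⟩

/-- The function `x ↦ max {μ | x + μ q ∈ A}` on `P_q A`, encoded as `-f_{A,-q}` so that it inherits
the continuity of the lower functions of a `P`-set; `projHyperplane (-q)` only serves to regard `x`
as a point of `orthHyperplane (-q)`. -/
noncomputable def upperFunction (A : Set (EuclideanSpace ℝ (Fin n)))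
    (q : EuclideanSpace ℝ (Fin n)) (x : orthHyperplane q) : ℝ :=
  -lowerFunction A (-q) (projHyperplane (-q) x)

theorem coe_projHyperplane_neg_coe (x : orthHyperplane q) :
    (projHyperplane (-q) (x : EuclideanSpace ℝ (Fin n)) : EuclideanSpace ℝ (Fin n)) = x := by
  have hx : (x : EuclideanSpace ℝ (Fin n)) ∈ orthHyperplane (-q) := by
    rw [orthHyperplane, ← Set.neg_singleton, Submodule.span_neg]
    exact x.2
  exact congrArg Subtype.val (projHyperplane_coe (q := -q) ⟨x, hx⟩)

theorem mapsTo_projHyperplane_neg : MapsTo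
    (fun x : orthHyperplane q => projHyperplane (-q) (x : EuclideanSpace ℝ (Fin n)))
    (projHyperplane q '' A) (projHyperplane (-q) '' A) := by
  rintro _ ⟨z, hz, rfl⟩
  refine ⟨z, hz, projHyperplane_eq_iff.2 ?_⟩
  rw [← Set.neg_singleton, Submodule.span_neg]
  exact projHyperplane_eq_iff.1 (projHyperplane_coe _).symm

theorem isGreatest_upperFunction (hA : IsCompact A) (hq : ‖q‖ = 1) {x : orthHyperplane q}
    (hx : x ∈ projHyperplane q '' A) :
    IsGreatest {μ : ℝ | (x : EuclideanSpace ℝ (Fin n)) + μ • q ∈ A} (upperFunction A q x) := by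
  have hleast := isLeast_lowerFunction hA ((norm_neg q).trans hq) (mapsTo_projHyperplane_neg hx)
  simp only [coe_projHyperplane_neg_coe, smul_neg, ← neg_smul] at hleast
  refine ⟨hleast.1, fun μ hμ => le_neg.1 (hleast.2 ?_)⟩
  rwa [mem_ofPred_eq, neg_neg]

namespace IsPSet

theorem continuousOn_upperFunction (hA : IsPSet A) (hq : ‖q‖ = 1) :
    ContinuousOn (upperFunction A q) (projHyperplane q '' A) :=
  ((hA.2.2 (-q) ((norm_neg q).trans hq)).comp (by fun_prop) mapsTo_projHyperplane_neg).neg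

theorem openWithinAt_projHyperplane (hA : IsPSet A) (hq : ‖q‖ = 1)
    {z : EuclideanSpace ℝ (Fin n)} (hz : z ∈ A) : OpenWithinAt (projHyperplane q) A z := by
  have hPz := mem_image_of_mem (projHyperplane q) hz
  have hleast := fun x => isLeast_lowerFunction hA.2.1 hq (x := x)
  have hgreatest := fun x => isGreatest_upperFunction hA.2.1 hq (x := x)
  let height (x : orthHyperplane q) : ℝ :=
    max (lowerFunction A q x) (min (inner ℝ q z) (upperFunction A q x))
  have hheight : ContinuousOn height (projHyperplane q '' A) :=
    (hA.2.2 q hq).sup (continuousOn_const.inf (hA.continuousOn_upperFunction hq))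
  have hheight_z : height (projHyperplane q z) = inner ℝ q z := by
    have hmem : inner ℝ q z ∈
        {μ : ℝ | (projHyperplane q z : EuclideanSpace ℝ (Fin n)) + μ • q ∈ A} := by
      rwa [mem_ofPred_eq, coe_projHyperplane_add_inner_smul hq]
    simp only [height, min_eq_left ((hgreatest _ hPz).2 hmem),
      max_eq_right ((hleast _ hPz).2 hmem)]
  refine OpenWithinAt.of_rightInvOn
    (s := fun x => (x : EuclideanSpace ℝ (Fin n)) + height x • q) ?_ ?_ ?_ ?_
  · exact continuous_subtype_val.continuousWithinAt.add
      ((hheight _ hPz).smul continuousWithinAt_const)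
  · rw [hheight_z, coe_projHyperplane_add_inner_smul hq]
  · intro x hx
    exact (ordConnected_setOf_add_smul_mem hA.1 _ q).out (hleast x hx).1 (hgreatest x hx).1
      ⟨le_max_left _ _, max_le ((hleast x hx).2 (hgreatest x hx).1) (min_le_right _ _)⟩
  · exact fun x _ => projHyperplane_coe_add_smul x _

theorem openWithinAt_linearMap (hA : IsPSet A) {F : Type*} [AddCommGroup F] [Module ℝ F]
    [TopologicalSpace F] [IsTopologicalAddGroup F] [ContinuousSMul ℝ F] [T2Space F]
    (L : EuclideanSpace ℝ (Fin n) →ₗ[ℝ] F) {z : EuclideanSpace ℝ (Fin n)} (hz : z ∈ A) :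
    OpenWithinAt L A z := by
  refine openWithinAt_of_isCompact hA.2.1 L.continuous_of_finiteDimensional.continuousOn
    fun U hU w _ hwz => ?_
  obtain rfl | hne := eq_or_ne w z
  · exact mem_of_superset hU fun b hb => ⟨b, hb, rfl⟩
  let q := NormedSpace.normalize (w - z)
  have hq : ‖q‖ = 1 := NormedSpace.norm_normalize_eq_one_iff.2 (sub_ne_zero.2 hne)
  have hPwz : projHyperplane q w = projHyperplane q z :=
    projHyperplane_eq_iff.2 (Submodule.mem_span_singleton.2
      ⟨‖w - z‖, NormedSpace.norm_smul_normalize (w - z)⟩)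
  have hker : Submodule.span ℝ {q} ≤ L.ker := by
    rw [Submodule.span_singleton_le_iff_mem, LinearMap.mem_ker]
    simp only [q, NormedSpace.normalize, map_smul, map_sub, hwz, sub_self, smul_zero]
  filter_upwards [(hA.openWithinAt_projHyperplane hq hz).eventually_exists_mem_eq
    (projHyperplane q).continuous.continuousWithinAt hPwz hU]
  rintro b ⟨u, hu, hub⟩
  exact ⟨u, hu, LinearMap.sub_mem_ker_iff.1 (hker (projHyperplane_eq_iff.1 hub))⟩

end IsPSet

end Projection

theorem theorem2 (n : ℕ) (A : Set (EuclideanSpace ℝ (Fin n)))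
    (hconv : Convex ℝ A) (hcomp : IsCompact A) :
    IsPSet A ↔
      ∀ (m : ℕ) (L : EuclideanSpace ℝ (Fin n) →ₗ[ℝ] EuclideanSpace ℝ (Fin m)),
        IsOpenMap (Set.imageFactorization L A) := by
  constructor
  · exact fun hA m L => isOpenMap_imageFactorization_iff.2 fun z hz =>
      hA.openWithinAt_linearMap L hz
  · refine fun h => ⟨hconv, hcomp, fun q hq => continuousOn_lowerFunction hcomp hq fun z hz => ?_⟩
    have hcoe := isOpenMap_imageFactorization_iff.1
      (h n ((orthHyperplane q).subtype ∘ₗ (projHyperplane q).toLinearMap)) z hz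
    exact OpenWithinAt.of_comp continuous_subtype_val Subtype.val_injective hcoe
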